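/- Let $X$ be a finite-dimensional real Banach space with dual $X^*$, let $X_+\subset X$ be a nonempty closed convex cone, and let $Y_+=\{p\in X^*:\langle p,x\rangle\ge 0\ \ \forall x\in X_+\}$. Let $u:X\to\overline{\mathbb R}$ be a function that is real-valued on $X_+$ and upper semicontinuous on $X_+$. For $p\in Y_+$ put $B(p)=\{x\in X_+:\langle p,x\rangle\le 1\}$, and put $B(p)=\emptyset$ for $p\in X^*\setminus Y_+$. For $p\in X^*$ let $v(p)=\sup\{u(x):x\in B(p)\}$ (with $\sup\emptyset=-\infty$) and $D(p)=\{x\in B(p):u(x)=v(p)\}$. Assume the non satiety condition (NSC): for all $x\in X_+$ and $p\in Y_+$ with $\langle p,x\rangle<1$ there is $x'\in X_+$ with $u(x')>u(x)$ (this holds in particular if $x'$ can always be found in $B(p)$, i.e. if $u(x)<v(p)$ for all such $x,p$). For a subset $\Omega$ of a normed space $E$, $x\in\Omega$ and $\varepsilon\ge0$, let $\widehat N_\varepsilon(x;\Omega)$ be the set of $x^*\in E^*$ with $\limsup_{z\to x,\,z\in\Omega}\langle x^*,z-x\rangle/\|z-x\|\le\varepsilon$, and let $N(x;\Omega)$ be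 the set of all $x^*\in E^*$ for which there are $\varepsilon_k\downarrow0$, $x_k\to x$ with $x_k\in\Omega$, and $x_k^*\in\widehat N_{\varepsilon_k}(x_k;\Omega)$ converging weak$^*$ to $x^*$. For $\varphi:E\to\overline{\mathbb R}$ finite at $x$ let $$\partial\varphi(x)=\{x^*:(x^*,-1)\in N((x,\varphi(x));\operatorname{epi}\varphi)\},\qquad \partial^\infty\varphi(x)=\{x^*:(x^*,0)\in N((x,\varphi(x));\operatorname{epi}\varphi)\},$$ and let both sets be empty if $\varphi(x)$ is infinite. Let $\bar p\in\operatorname{int}Y_+$, and suppose that $u$ is strictly differentiable at every point of $D(\bar p)$ (in particular, finite near each such point). Then, identifying $X^{**}$ with $X$, $$\partial(-v)(\bar p)\subset\{\langle\nabla u(\bar x),\bar x\rangle\,\bar x:\bar x\in D(\bar p)\}\qquad\text{and}\qquad \partial^\infty(-v)(\bar p)=\{0\}.$$ -/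

import Mathlib

open Filter Topology

/-! Generalized differentiation in a normed space `E` with dual `E* = StrongDual ℝ E`. -/

section Variational

variable {E : Type*} [NormedAddCommGroup E] [NormedSpace ℝ E]

/-- The set `N̂_ε(x; Ω)` of `ε`-normals to `Ω` at `x`: those `x*` with
`limsup_{u → x, u ∈ Ω} ⟨x*, u - x⟩ / ‖u - x‖ ≤ ε`; it is empty if `x ∉ Ω`.
The upper limit is unfolded and the denominator cleared. -/
def epsNormals (ε : ℝ) (Ω : Set E) (x : E) : Set (StrongDual ℝ E) :=
  {f | x ∈ Ω ∧ ∀ δ : ℝ, 0 < δ → ∀ᶠ u in 𝓝[Ω] x, f (u - x) ≤ (ε + δ) * ‖u - x‖}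

/-- The limiting (Mordukhovich) normal cone `N(x; Ω)`: the sequential weak* limits of
`ε k`-normals at points `z k ∈ Ω` with `z k → x` and `ε k ↓ 0`; it is empty if `x ∉ Ω`.
Weak* convergence of a sequence of functionals is pointwise convergence.
(Replacing the norm by an equivalent one does not change this cone.) -/
def limitingNormalCone (Ω : Set E) (x : E) : Set (StrongDual ℝ E) :=
  {f | x ∈ Ω ∧ ∃ (ε : ℕ → ℝ) (z : ℕ → E) (g : ℕ → StrongDual ℝ E),
    (∀ k, 0 ≤ ε k) ∧ Tendsto ε atTop (𝓝 0) ∧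
    (∀ k, z k ∈ Ω) ∧ Tendsto z atTop (𝓝 x) ∧
    (∀ k, g k ∈ epsNormals (ε k) Ω (z k)) ∧
    ∀ y, Tendsto (fun k => g k y) atTop (𝓝 (f y))}

/-- The epigraph of an extended-real-valued function. -/
def epigraph (φ : E → EReal) : Set (E × ℝ) :=
  {q | φ q.1 ≤ (q.2 : EReal)}

/-- The functional `(ξ, r) ∈ (E × ℝ)*`, that is `(x, t) ↦ ⟨ξ, x⟩ + r t`. -/
noncomputable def dualPair (ξ : StrongDual ℝ E) (r : ℝ) : StrongDual ℝ (E × ℝ) :=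
  ξ.coprod (r • ContinuousLinearMap.id ℝ ℝ)

/-- The limiting (Mordukhovich) subdifferential `∂φ(x)`; it is empty if `φ x` is infinite. -/
noncomputable def limitingSubdifferential (φ : E → EReal) (x : E) : Set (StrongDual ℝ E) :=
  {ξ | φ x ≠ ⊤ ∧ φ x ≠ ⊥ ∧
    dualPair ξ (-1) ∈ limitingNormalCone (epigraph φ) (x, (φ x).toReal)}

/-- The singular subdifferential `∂^∞ φ(x)`; it is empty if `φ x` is infinite. -/
noncomputable def singularSubdifferential (φ : E → EReal) (x : E) : Set (StrongDual ℝ E) :=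
  {ξ | φ x ≠ ⊤ ∧ φ x ≠ ⊥ ∧
    dualPair ξ 0 ∈ limitingNormalCone (epigraph φ) (x, (φ x).toReal)}

/-- Strict differentiability at `x` of an extended-real-valued function: it is finite near `x` and,
as a real function there, it has a strict Fréchet derivative at `x`. -/
def StrictlyDifferentiableAt (u : E → EReal) (x : E) : Prop :=
  (∀ᶠ y in 𝓝 x, u y ≠ ⊤ ∧ u y ≠ ⊥) ∧
    ∃ f : StrongDual ℝ E, HasStrictFDerivAt (fun y => (u y).toReal) f x

/-- The derivative `∇u(x)` at `x` of an extended-real-valued function that is finite near `x` and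
Fréchet differentiable at `x`. -/
noncomputable def nabla (u : E → EReal) (x : E) : StrongDual ℝ E :=
  fderiv ℝ (fun y => (u y).toReal) x

end Variational

/-! The consumer problem with cone of goods `Xp` and utility function `u`. -/

section Consumer

variable {X : Type*} [NormedAddCommGroup X] [NormedSpace ℝ X]

/-- The set of prices: the positive dual cone of the cone of goods. -/
def priceCone (Xp : ProperCone ℝ X) : Set (StrongDual ℝ X) :=
  {p | ∀ x ∈ Xp, 0 ≤ p x}

/-- The budget set `B(p)`; it is empty if `p` is not a price. -/
def budget (Xp : ProperCone ℝ X) (p : StrongDual ℝ X) : Set X :=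
  {x | p ∈ priceCone Xp ∧ x ∈ Xp ∧ p x ≤ 1}

/-- The indirect utility function `v(p) = sup {u(x) : x ∈ B(p)}`, with `sup ∅ = -∞`. -/
noncomputable def indirectUtility (Xp : ProperCone ℝ X) (u : X → EReal)
    (p : StrongDual ℝ X) : EReal :=
  sSup (u '' budget Xp p)

/-- The demand set `D(p)`; it is empty if `p` is not a price. -/
def demand (Xp : ProperCone ℝ X) (u : X → EReal) (p : StrongDual ℝ X) : Set X :=
  {x | x ∈ budget Xp p ∧ u x = indirectUtility Xp u p}

/-- The non satiety condition. It is not required that `x'` be affordable at the price `p`, so the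
condition follows from the variant with `x' ∈ B(p)`, that is `u(x) < v(p)`. -/
def NonSatiety (Xp : ProperCone ℝ X) (u : X → EReal) : Prop :=
  ∀ x ∈ Xp, ∀ p ∈ priceCone Xp, p x < 1 → ∃ x' ∈ Xp, u x < u x'

end Consumer

/-! If `x` is demanded at a price `q`, then `(1 + t h(x))⁻¹ x` is affordable at `q + t h`, so it
bounds `-v(q + t h)` from above. Strict differentiability at `a` makes the resulting growth rate
`⟨∇u(a), a⟩ h(a) + η` valid for all demands `x` near `a`: the epigraph of `-v` contains short
segments in one fixed direction (`eventually_segment_mem_epigraph`). An `ε`-normal is at most `ε`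
times the norm on such a direction (`epsNormals_apply_le`). Along a sequence defining a limiting
normal `(ξ, r)` at `p`, demands cluster at some `a ∈ D(p)` (`exists_subseq_demand_tendsto`). In the
limit `ξ(h) ≤ -r ⟨∇u(a), a⟩ h(a)` for every `h`; both sides are linear in `h`, so equality holds.
Take `r = -1` and `r = 0`. -/

section Variational

/-! ### Normals along segments and radial contractions. -/

variable {E : Type*} [NormedAddCommGroup E] [NormedSpace ℝ E]

/-- An `ε`-normal grows at rate at most `ε` in every direction along which a segment stays in
the set. -/
theorem epsNormals_apply_le {ε : ℝ} {Ω : Set E} {z d : E} {f : StrongDual ℝ E}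
    (hf : f ∈ epsNormals ε Ω z) (hd : ∀ᶠ t : ℝ in 𝓝[>] 0, z + t • d ∈ Ω) :
    f d ≤ ε * ‖d‖ := by
  have key : ∀ δ : ℝ, 0 < δ → f d ≤ (ε + δ) * ‖d‖ := by
    intro δ hδ
    have hcont : Tendsto (fun t : ℝ => z + t • d) (𝓝[>] 0) (𝓝 z) := by
      have h : Continuous fun t : ℝ => z + t • d := by fun_prop
      have h0 := h.tendsto 0
      rw [zero_smul, add_zero] at h0
      exact h0.mono_left nhdsWithin_le_nhds
    have hlim : Tendsto (fun t : ℝ => z + t • d) (𝓝[>] 0) (𝓝[Ω] z) :=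
      tendsto_nhdsWithin_iff.2 ⟨hcont, hd⟩
    obtain ⟨t, ht, ht0⟩ := ((hlim.eventually (hf.2 δ hδ)).and self_mem_nhdsWithin).exists
    have ht0 : 0 < t := ht0
    rw [add_sub_cancel_left, map_smul, smul_eq_mul, norm_smul, Real.norm_of_nonneg ht0.le] at ht
    refine le_of_mul_le_mul_left ?_ ht0
    linarith
  have hlim : Tendsto (fun δ : ℝ => (ε + δ) * ‖d‖) (𝓝[>] 0) (𝓝 (ε * ‖d‖)) := by
    have h : Continuous fun δ : ℝ => (ε + δ) * ‖d‖ := by fun_prop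
    have h0 := h.tendsto 0
    rw [add_zero] at h0
    exact h0.mono_left nhdsWithin_le_nhds
  exact ge_of_tendsto hlim (eventually_mem_nhdsWithin.mono fun δ hδ => key δ hδ)

theorem zero_mem_limitingNormalCone {Ω : Set E} {x : E} (hx : x ∈ Ω) :
    (0 : StrongDual ℝ E) ∈ limitingNormalCone Ω x := by
  refine ⟨hx, fun _ => 0, fun _ => x, fun _ => 0, fun _ => le_rfl, tendsto_const_nhds,
    fun _ => hx, tendsto_const_nhds, fun _ => ⟨hx, fun δ hδ => Eventually.of_forall fun y => ?_⟩,
    fun _ => tendsto_const_nhds⟩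
  simp only [zero_add, zero_apply]
  positivity

theorem dualPair_apply (ξ : StrongDual ℝ E) (r : ℝ) (y : E) (s : ℝ) :
    dualPair ξ r (y, s) = ξ y + r * s := by
  simp [dualPair]

/-- Lower estimate, uniform in the base point, for a strictly differentiable function along the
radial contractions `t ↦ (1 + t h(x))⁻¹ x`. -/
theorem eventually_radial_lower_bound {U : E → ℝ} {f : StrongDual ℝ E} {a : E}
    (hU : HasStrictFDerivAt U f a) (h : StrongDual ℝ E) {η : ℝ} (hη : 0 < η) :
    ∀ᶠ x in 𝓝 a, ∀ᶠ t : ℝ in 𝓝 0, 0 < t →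
      U x - t * (f a * h a + η) ≤ U ((1 + t * h x)⁻¹ • x) := by
  -- Tolerance for the strict derivative, small enough that the error `c |h a| ‖a‖` stays below `η`;
  -- the `+ 1` covers `h a = 0` or `a = 0`.
  set c : ℝ := η / (2 * (|h a| * ‖a‖ + 1)) with hc
  have hden : 0 < |h a| * ‖a‖ + 1 := by positivity
  have hcpos : 0 < c := by positivity
  have hca : c * (|h a| * ‖a‖) < η := by
    rw [hc, div_mul_eq_mul_div, div_lt_iff₀ (by positivity)]
    nlinarith [mul_pos hη hden]
  have hne : (1 + (a, (0 : ℝ)).2 * h (a, (0 : ℝ)).1) ≠ 0 := by simp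
  have hcontr : ContinuousAt (fun w : E × ℝ => (1 + w.2 * h w.1)⁻¹ • w.1) (a, 0) := by
    refine ContinuousAt.smul (ContinuousAt.inv₀ ?_ hne) continuousAt_fst
    fun_prop
  have hpair : Tendsto (fun w : E × ℝ => ((1 + w.2 * h w.1)⁻¹ • w.1, w.1)) (𝓝 (a, 0))
      (𝓝 (a, a)) := by
    have := hcontr.prodMk continuousAt_fst
    simpa [ContinuousAt] using this
  have hbound := hpair.eventually (hU.isLittleO.bound hcpos)
  -- Upper bound for the loss of `U` per unit of `t`: linear part plus error.
  have hrate : ContinuousAt (fun w : E × ℝ => h w.1 * (1 + w.2 * h w.1)⁻¹ * f w.1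
      + c * (|h w.1 * (1 + w.2 * h w.1)⁻¹| * ‖w.1‖)) (a, 0) := by
    have hinv : ContinuousAt (fun w : E × ℝ => (1 + w.2 * h w.1)⁻¹) (a, 0) :=
      ContinuousAt.inv₀ (by fun_prop) hne
    fun_prop
  have hlt := hrate.eventually_lt (g := fun _ => f a * h a + η) continuousAt_const (by
    simp only [zero_mul, add_zero, inv_one, mul_one]
    linarith)
  have hpos : ∀ᶠ w : E × ℝ in 𝓝 (a, 0), 1 + w.2 * h w.1 ≠ 0 :=
    ContinuousAt.eventually_ne (by fun_prop) hne
  have hall := (hbound.and hlt).and hpos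
  rw [nhds_prod_eq] at hall
  -- A neighbourhood of `(a, 0)` is split into `x` near `a`, then `t` near `0`.
  refine hall.curry.mono fun x hx => hx.mono fun t ht ht0 => ?_
  obtain ⟨⟨h1, h2⟩, h3⟩ := ht
  simp only at h1 h2 h3
  have hdiff : (1 + t * h x)⁻¹ • x - x = (-(t * (h x * (1 + t * h x)⁻¹))) • x := by
    have : (1 + t * h x)⁻¹ - 1 = -(t * (h x * (1 + t * h x)⁻¹)) := by
      field_simp
      ring
    rw [← this, sub_smul, one_smul]
  rw [hdiff, norm_smul, map_smul, smul_eq_mul, Real.norm_eq_abs, Real.norm_eq_abs, abs_neg,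
    abs_mul, abs_of_pos ht0] at h1
  have h4 := neg_le_of_abs_le h1
  nlinarith [mul_lt_mul_of_pos_left h2 ht0]

end Variational

/-! ### Demand and the epigraph of `-v` near an interior price. -/

section Consumer

variable {X : Type*} [NormedAddCommGroup X] [NormedSpace ℝ X]

/-- Prices near an interior price are uniformly coercive on the cone of goods. -/
theorem exists_coercive_of_mem_interior_priceCone {Xp : ProperCone ℝ X} {p : StrongDual ℝ X}
    (hp : p ∈ interior (priceCone Xp)) :
    ∃ r : ℝ, 0 < r ∧ ∀ᶠ q in 𝓝 p, q ∈ priceCone Xp ∧ ∀ x ∈ Xp, r * ‖x‖ ≤ q x := by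
  obtain ⟨ρ, hρ, hball⟩ := Metric.mem_nhds_iff.1 (mem_interior_iff_mem_nhds.1 hp)
  refine ⟨ρ / 2, by positivity, ?_⟩
  filter_upwards [Metric.ball_mem_nhds p (half_pos hρ)] with q hq
  rw [Metric.mem_ball, dist_eq_norm] at hq
  refine ⟨hball (by rw [Metric.mem_ball, dist_eq_norm]; linarith), fun x hx => ?_⟩
  -- Lowering `q` by `ρ / 2` times a norming functional of `x` still leaves a price; its
  -- nonnegativity at `x` is the estimate.
  obtain ⟨g, hg, hgx⟩ := exists_dual_vector'' ℝ x
  have hmem : q - (ρ / 2) • g ∈ priceCone Xp := by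
    refine hball ?_
    rw [Metric.mem_ball, dist_eq_norm]
    calc ‖q - (ρ / 2) • g - p‖ = ‖(q - p) - (ρ / 2) • g‖ := by congr 1; abel
      _ ≤ ‖q - p‖ + ‖(ρ / 2) • g‖ := norm_sub_le _ _
      _ < ρ := by
        rw [norm_smul, Real.norm_of_nonneg (by positivity)]
        nlinarith
  have := hmem x hx
  simp only [sub_apply, smul_apply, smul_eq_mul, hgx,
    RCLike.ofReal_real_eq_id, id_eq] at this
  linarith

theorem le_indirectUtility {Xp : ProperCone ℝ X} (u : X → EReal) {p : StrongDual ℝ X} {x : X}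
    (hx : x ∈ budget Xp p) : u x ≤ indirectUtility Xp u p :=
  le_sSup ⟨x, hx, rfl⟩

theorem norm_le_of_mem_budget {Xp : ProperCone ℝ X} {p : StrongDual ℝ X} {r : ℝ} (hr : 0 < r)
    (hpr : ∀ x ∈ Xp, r * ‖x‖ ≤ p x) {x : X} (hx : x ∈ budget Xp p) : ‖x‖ ≤ r⁻¹ := by
  rw [← one_div, le_div_iff₀' hr]
  exact (hpr x hx.2.1).trans hx.2.2

/-- Demand is nonempty at coercive prices. -/
theorem demand_nonempty [FiniteDimensional ℝ X] {Xp : ProperCone ℝ X} {u : X → EReal}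
    (husc : UpperSemicontinuousOn u (Xp : Set X)) {p : StrongDual ℝ X} (hp : p ∈ priceCone Xp)
    {r : ℝ} (hr : 0 < r) (hpr : ∀ x ∈ Xp, r * ‖x‖ ≤ p x) : (demand Xp u p).Nonempty := by
  have hset : budget Xp p = (Xp : Set X) ∩ {x | p x ≤ 1} := by
    ext x
    exact ⟨fun h => h.2, fun h => ⟨hp, h⟩⟩
  have hclosed : IsClosed (budget Xp p) := by
    rw [hset]
    exact Xp.isClosed.inter (isClosed_le (by fun_prop) continuous_const)
  have hcompact : IsCompact (budget Xp p) := by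
    have := FiniteDimensional.proper ℝ X
    refine (isCompact_closedBall (0 : X) r⁻¹).of_isClosed_subset hclosed fun x hx => ?_
    rw [mem_closedBall_zero_iff]
    exact norm_le_of_mem_budget hr hpr hx
  have hne : (budget Xp p).Nonempty := ⟨0, hp, Xp.zero_mem, by simp⟩
  obtain ⟨x, hx, hmax⟩ := UpperSemicontinuousOn.exists_isMaxOn hne hcompact
    (fun x hx => (husc x hx.2.1).mono fun y hy => hy.2.1)
  refine ⟨x, hx, le_antisymm (le_indirectUtility u hx) (sSup_le ?_)⟩
  rintro _ ⟨y, hy, rfl⟩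
  exact hmax hy

/-- The contraction `(1 + t h(x))⁻¹ x` of an affordable good is affordable when the price is
perturbed by `t h`. -/
theorem radial_mem_budget {Xp : ProperCone ℝ X} {q h : StrongDual ℝ X} {x : X} {t : ℝ}
    (hx : x ∈ budget Xp q) (hq : q + t • h ∈ priceCone Xp) (ht : 0 < 1 + t * h x) :
    (1 + t * h x)⁻¹ • x ∈ budget Xp (q + t • h) := by
  refine ⟨hq, Xp.smul_mem hx.2.1 (inv_nonneg.2 ht.le), ?_⟩
  rw [map_smul, smul_eq_mul, inv_mul_le_one₀ ht]
  simpa using hx.2.2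

/-- Near a price in the interior and a point of strict differentiability of the utility function,
the epigraph of `-v` contains small segments in the directions
`(h, ⟨∇u(a), a⟩ ⟨h, a⟩ + η)`, `η > 0`. -/
theorem eventually_segment_mem_epigraph {Xp : ProperCone ℝ X} {u : X → EReal} {a : X}
    (ha : StrictlyDifferentiableAt u a) (h : StrongDual ℝ X) {η : ℝ} (hη : 0 < η) :
    ∀ᶠ x in 𝓝 a, ∀ q ∈ interior (priceCone Xp), x ∈ demand Xp u q →
      ∀ s : ℝ, (q, s) ∈ epigraph (fun q => -indirectUtility Xp u q) →
      ∀ᶠ t : ℝ in 𝓝[>] 0, (q, s) + t • (h, nabla u a a * h a + η) ∈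
        epigraph (fun q => -indirectUtility Xp u q) := by
  obtain ⟨hfin, f, hf⟩ := ha
  have hnab : nabla u a = f := hf.hasFDerivAt.fderiv
  rw [hnab]
  filter_upwards [eventually_radial_lower_bound hf h hη, hfin.eventually_nhds] with
    x hx hfinx q hq hxq s hs
  have hcone : ∀ᶠ t : ℝ in 𝓝 0, q + t • h ∈ priceCone Xp := by
    have hc : ContinuousAt (fun t : ℝ => q + t • h) 0 := by fun_prop
    refine hc.eventually_mem ?_
    rw [zero_smul, add_zero]
    exact mem_interior_iff_mem_nhds.1 hq
  have hpos : ∀ᶠ t : ℝ in 𝓝 0, 0 < 1 + t * h x := by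
    have hc : ContinuousAt (fun t : ℝ => 1 + t * h x) 0 := by fun_prop
    exact hc.eventually_mem (Ioi_mem_nhds (by simp))
  have hfint : ∀ᶠ t : ℝ in 𝓝 0, u ((1 + t * h x)⁻¹ • x) ≠ ⊤ ∧ u ((1 + t * h x)⁻¹ • x) ≠ ⊥ := by
    have hc : ContinuousAt (fun t : ℝ => (1 + t * h x)⁻¹ • x) 0 :=
      ContinuousAt.smul (ContinuousAt.inv₀ (by fun_prop) (by simp)) continuousAt_const
    refine hc.eventually (p := fun y => u y ≠ ⊤ ∧ u y ≠ ⊥) ?_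
    simpa using hfinx
  filter_upwards [nhdsWithin_le_nhds hx, nhdsWithin_le_nhds hcone, nhdsWithin_le_nhds hpos,
    nhdsWithin_le_nhds hfint, self_mem_nhdsWithin] with t h1 h2 h3 h4 ht
  have h1 := h1 ht
  have h5 := le_indirectUtility u (radial_mem_budget hxq.1 h2 h3)
  change -indirectUtility Xp u q ≤ (s : EReal) at hs
  change -indirectUtility Xp u (q + t • h) ≤ ((s + t * (f a * h a + η) : ℝ) : EReal)
  rw [← hxq.2, ← EReal.coe_toReal hfinx.self_of_nhds.1 hfinx.self_of_nhds.2, ← EReal.coe_neg,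
    EReal.coe_le_coe_iff] at hs
  refine (EReal.neg_le_neg_iff.2 h5).trans ?_
  rw [← EReal.coe_toReal h4.1 h4.2, ← EReal.coe_neg, EReal.coe_le_coe_iff]
  linarith

/-- Any sequence of prices tending to an interior price, with values `t k ≥ -v(q k)` tending to
`-v(p)`, has demands that cluster at a demand of the limit price. -/
theorem exists_subseq_demand_tendsto [FiniteDimensional ℝ X] {Xp : ProperCone ℝ X}
    {u : X → EReal} (husc : UpperSemicontinuousOn u (Xp : Set X)) {p : StrongDual ℝ X}
    (hp : p ∈ interior (priceCone Xp)) {q : ℕ → StrongDual ℝ X} {t : ℕ → ℝ} {τ : ℝ}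
    (hq : Tendsto q atTop (𝓝 p)) (ht : Tendsto t atTop (𝓝 τ))
    (hqt : ∀ k, (q k, t k) ∈ epigraph (fun q => -indirectUtility Xp u q))
    (hτ : -indirectUtility Xp u p = τ) :
    ∃ a ∈ demand Xp u p, ∃ (x : ℕ → X) (φ : ℕ → ℕ), StrictMono φ ∧
      Tendsto (x ∘ φ) atTop (𝓝 a) ∧ ∀ᶠ k in atTop, x k ∈ demand Xp u (q k) := by
  obtain ⟨r, hr, hcoer⟩ := exists_coercive_of_mem_interior_priceCone hp
  have hcoer' := hq.eventually hcoer
  have hex : ∀ k, ∃ x : X, (q k ∈ priceCone Xp ∧ ∀ x ∈ Xp, r * ‖x‖ ≤ q k x) →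
      x ∈ demand Xp u (q k) := by
    intro k
    by_cases hk : q k ∈ priceCone Xp ∧ ∀ x ∈ Xp, r * ‖x‖ ≤ q k x
    · obtain ⟨x, hx⟩ := demand_nonempty husc hk.1 hr hk.2
      exact ⟨x, fun _ => hx⟩
    -- Junk value for the finitely many `k` whose price is not yet coercive.
    · exact ⟨0, fun h => absurd h hk⟩
  choose x hx using hex
  have hxd : ∀ᶠ k in atTop, x k ∈ demand Xp u (q k) := hcoer'.mono fun k hk => hx k hk
  have := FiniteDimensional.proper ℝ X
  have hball : ∀ᶠ k in atTop, x k ∈ Metric.closedBall (0 : X) r⁻¹ := by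
    filter_upwards [hcoer', hxd] with k hk hxk
    rw [mem_closedBall_zero_iff]
    exact norm_le_of_mem_budget hr hk.2 hxk.1
  obtain ⟨a, -, φ, hφ, hlim⟩ :=
    (isCompact_closedBall (0 : X) r⁻¹).tendsto_subseq' hball.frequently
  have hxφ : ∀ᶠ k in atTop, x (φ k) ∈ demand Xp u (q (φ k)) := hφ.tendsto_atTop.eventually hxd
  have haXp : a ∈ Xp := Xp.isClosed.mem_of_tendsto hlim (hxφ.mono fun k hk => hk.1.2.1)
  have hpa : p a ≤ 1 := by
    have hqφ : Tendsto (fun k => q (φ k)) atTop (𝓝 p) := hq.comp hφ.tendsto_atTop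
    have hev : Tendsto (fun k => q (φ k) (x (φ k))) atTop (𝓝 (p a)) :=
      ((isBoundedBilinearMap_apply (𝕜 := ℝ) (E := X) (F := ℝ)).continuous.tendsto (p, a)).comp
        (hqφ.prodMk_nhds hlim)
    exact le_of_tendsto hev (hxφ.mono fun k hk => hk.1.2.2)
  have haB : a ∈ budget Xp p := ⟨interior_subset hp, haXp, hpa⟩
  refine ⟨a, ⟨haB, le_antisymm (le_indirectUtility u haB) ?_⟩, x, φ, hφ, hlim, hxd⟩
  -- With `u a < c < v(p)`, upper semicontinuity gives `u(x_k) < c` along the subsequence, while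
  -- `-u(x_k) = -v(q_k) ≤ t_k → -v(p) < -c` gives the opposite.
  by_contra! hlt
  obtain ⟨c, hc1, hc2⟩ := exists_between hlt
  have hlimW : Tendsto (x ∘ φ) atTop (𝓝[(Xp : Set X)] a) :=
    tendsto_nhdsWithin_iff.2 ⟨hlim, hxφ.mono fun k hk => hk.1.2.1⟩
  have hev1 : ∀ᶠ k in atTop, u (x (φ k)) < c :=
    hlimW.eventually (upperSemicontinuousWithinAt_iff.1 (husc a haXp) c hc1)
  have htE : Tendsto (fun k => (t (φ k) : EReal)) atTop (𝓝 (τ : EReal)) :=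
    (continuous_coe_real_ereal.tendsto τ).comp (ht.comp hφ.tendsto_atTop)
  have hev2 : ∀ᶠ k in atTop, (t (φ k) : EReal) < -c := by
    refine htE.eventually_lt_const ?_
    rw [← hτ]
    exact EReal.neg_lt_neg_iff.2 hc2
  obtain ⟨k, hk, hk1, hk2⟩ := (hxφ.and (hev1.and hev2)).exists
  have h3 : -indirectUtility Xp u (q (φ k)) ≤ (t (φ k) : EReal) := hqt (φ k)
  rw [← hk.2] at h3
  exact absurd (EReal.neg_lt_neg_iff.1 (h3.trans_lt hk2)) hk1.not_gt

/-- Limiting normals to the epigraph of `-v` at an interior price. -/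
theorem eq_smul_of_dualPair_mem_limitingNormalCone [FiniteDimensional ℝ X] {Xp : ProperCone ℝ X}
    {u : X → EReal} (husc : UpperSemicontinuousOn u (Xp : Set X)) {p : StrongDual ℝ X}
    (hp : p ∈ interior (priceCone Xp))
    (hdiff : ∀ x ∈ demand Xp u p, StrictlyDifferentiableAt u x)
    (htop : -indirectUtility Xp u p ≠ ⊤) (hbot : -indirectUtility Xp u p ≠ ⊥)
    {ξ : StrongDual ℝ (StrongDual ℝ X)} {r : ℝ}
    (hξ : dualPair ξ r ∈ limitingNormalCone (epigraph fun q => -indirectUtility Xp u q)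
      (p, (-indirectUtility Xp u p).toReal)) :
    ∃ x ∈ demand Xp u p,
      ξ = (-r * nabla u x x) • NormedSpace.inclusionInDoubleDual ℝ X x := by
  obtain ⟨-, ε, z, g, -, hε, hzΩ, hz, hg, hlim⟩ := hξ
  have hq : Tendsto (fun k => (z k).1) atTop (𝓝 p) := (continuous_fst.tendsto _).comp hz
  have ht : Tendsto (fun k => (z k).2) atTop (𝓝 (-indirectUtility Xp u p).toReal) :=
    (continuous_snd.tendsto _).comp hz
  obtain ⟨a, ha, x, φ, hφ, hxa, hxd⟩ := exists_subseq_demand_tendsto husc hp hq ht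
    (fun k => hzΩ k) (EReal.coe_toReal htop hbot).symm
  refine ⟨a, ha, ?_⟩
  have key : ∀ h : StrongDual ℝ X, ξ h ≤ -r * nabla u a a * h a := by
    intro h
    have hη : ∀ η : ℝ, 0 < η → ξ h + r * (nabla u a a * h a + η) ≤ 0 := by
      intro η hη
      set d : StrongDual ℝ X × ℝ := (h, nabla u a a * h a + η) with hd
      have hle : ∀ᶠ k in atTop, g (φ k) d ≤ ε (φ k) * ‖d‖ := by
        filter_upwards [hxa.eventually (eventually_segment_mem_epigraph (Xp := Xp)
          (hdiff a ha) h hη), hφ.tendsto_atTop.eventually hxd,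
          hφ.tendsto_atTop.eventually (hq.eventually_mem (isOpen_interior.mem_nhds hp))]
          with k h1 h2 h3
        exact epsNormals_apply_le (hg (φ k)) (h1 _ h3 h2 _ (hzΩ (φ k)))
      have hl : Tendsto (fun k => g (φ k) d) atTop (𝓝 (dualPair ξ r d)) :=
        (hlim d).comp hφ.tendsto_atTop
      have hr : Tendsto (fun k => ε (φ k) * ‖d‖) atTop (𝓝 (0 * ‖d‖)) :=
        (hε.comp hφ.tendsto_atTop).mul_const _
      have := le_of_tendsto_of_tendsto hl hr hle
      rwa [hd, dualPair_apply, zero_mul] at this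
    have hcont : Continuous fun η : ℝ => ξ h + r * (nabla u a a * h a + η) := by fun_prop
    have h0 := (hcont.tendsto 0).mono_left (nhdsWithin_le_nhds (s := Set.Ioi 0))
    have := le_of_tendsto h0 (eventually_mem_nhdsWithin.mono fun η h => hη η h)
    linarith
  ext h
  have h1 := key h
  have h2 := key (-h)
  simp only [map_neg, neg_apply] at h2
  simp only [smul_apply, NormedSpace.dual_def, smul_eq_mul]
  linarith

end Consumer

theorem mainTheorem10 {X : Type*} [NormedAddCommGroup X] [NormedSpace ℝ X]
    [FiniteDimensional ℝ X] (Xp : ProperCone ℝ X) (u : X → EReal)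
    (hfin : ∀ x ∈ Xp, u x ≠ ⊤ ∧ u x ≠ ⊥)
    (husc : UpperSemicontinuousOn u (Xp : Set X))
    (hNSC : NonSatiety Xp u)
    (p : StrongDual ℝ X) (hp : p ∈ interior (priceCone Xp))
    (hdiff : ∀ x ∈ demand Xp u p, StrictlyDifferentiableAt u x) :
    limitingSubdifferential (fun q => -indirectUtility Xp u q) p ⊆
        {ξ | ∃ x ∈ demand Xp u p,
          ξ = nabla u x x • NormedSpace.inclusionInDoubleDual ℝ X x} ∧
      singularSubdifferential (fun q => -indirectUtility Xp u q) p = {0} := by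

  refine ⟨?_, Set.Subset.antisymm ?_ ?_⟩
  · rintro ξ ⟨htop, hbot, hξ⟩
    obtain ⟨x, hx, h⟩ :=
      eq_smul_of_dualPair_mem_limitingNormalCone husc hp hdiff htop hbot hξ
    exact ⟨x, hx, by simpa using h⟩
  · rintro ξ ⟨htop, hbot, hξ⟩
    obtain ⟨x, -, h⟩ :=
      eq_smul_of_dualPair_mem_limitingNormalCone husc hp hdiff htop hbot hξ
    simpa using h
  -- Zero is always a normal; what needs proof is that `v(p)` is finite, which holds because it is
  -- attained on the cone.
  · rintro ξ rfl
    obtain ⟨r, hr, hcoer⟩ := exists_coercive_of_mem_interior_priceCone hp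
    obtain ⟨x, hx⟩ := demand_nonempty husc hcoer.self_of_nhds.1 hr hcoer.self_of_nhds.2
    have hux := hfin x hx.1.2.1
    rw [hx.2] at hux
    have htop : -indirectUtility Xp u p ≠ ⊤ := by simpa using hux.2
    have hbot : -indirectUtility Xp u p ≠ ⊥ := by simpa using hux.1
    refine ⟨htop, hbot, ?_⟩
    have h0 : dualPair (0 : StrongDual ℝ (StrongDual ℝ X)) 0 = 0 := by
      ext <;> simp [dualPair]
    rw [h0]
    exact zero_mem_limitingNormalCone (EReal.coe_toReal htop hbot).ge
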